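/- Let $J$ be a commutative ring, let $G$ be a group with a normal subgroup $B$, and put $H=G/B$. Suppose that there is an exact sequence of $JG$-modules $$\cdots\to P_2\to P_1\to P_0\to J\to 0,$$ where $J$ is the trivial module, such that each $P_j$ is projective as a $JB$-module and $(*)$ the induced maps $P_j\otimes_{JB}J\to P_{j-1}\otimes_{JB}J$ are zero for all $j\ge 1$. Let $n\ge 0$ be an integer and suppose that $G$ is of type $\mathrm{FP}_n$ over $J$. Then for every $p$ with $0\le p\le n$ the homology group $H_p(B,J)$, with its natural $JH$-module structure, is of type $\mathrm{FP}_{n-p}$ as a $JH$-module. In particular, $H$ is of type $\mathrm{FP}_n$ over $J$. (Here a module $M$ over a ring $R$ is of type $\mathrm{FP}_m$ if it has a resolution by projective $R$-modules which are finitely generated in all degrees $\le m$; a group $\Gamma$ is of type $\mathrm{FP}_m$ over $J$ if the trivial module $J$ is of type $\mathrm{FP}_m$ over the group ring $J\Gamma$.) -/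

import Mathlib

open CategoryTheory

universe u

noncomputable section

/-- A module `M` over a ring `R` is of type `FP_n` if it has a resolution by projective modules
which are finitely generated in all degrees `i ≤ n`. -/
def ModuleCat.IsTypeFP {R : Type u} [Ring R] (M : ModuleCat.{u} R) (n : ℕ) : Prop :=
  ∃ P : ProjectiveResolution M, ∀ i ≤ n, Module.Finite R (P.complex.X i)

/-- A `J`-linear representation of `G` is of type `FP_n` if it is of type `FP_n` as a module over
the group ring `J[G]`. -/
def Rep.IsTypeFP {J G : Type u} [CommRing J] [Group G] (M : Rep.{u} J G) (n : ℕ) : Prop :=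
  ((Rep.toModuleMonoidAlgebra (k := J) (G := G)).obj M).IsTypeFP n

/-- A group `G` is of type `FP_n` over `J` if the trivial module `J` is of type `FP_n` over the
group ring `J[G]`. -/
def Group.IsTypeFP (J G : Type u) [CommRing J] [Group G] (n : ℕ) : Prop :=
  (Rep.trivial J G J).IsTypeFP n

instance Rep.quotientToCoinvariantsFunctor_additive (J : Type u) {G : Type u} [CommRing J]
    [Group G] (B : Subgroup G) [B.Normal] :
    (Rep.quotientToCoinvariantsFunctor.{u} J B).Additive where
  map_add {X Y f g} := by
    ext x
    obtain ⟨v, rfl⟩ := Representation.Coinvariants.mk_surjective _ x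
    rfl

/-- The homology `H_p(B, A)` of a normal subgroup `B` of `G` with coefficients in a `J[G]`-module
`A`, together with its natural structure of `J[G ⧸ B]`-module: it is the `p`-th left derived
functor of the functor of `B`-coinvariants from `J[G]`-modules to `J[G ⧸ B]`-modules. In other
words, it is the homology of `P_B = J ⊗_{J[B]} P`, where `P` is a projective resolution of `A`
over `J[G]` (and hence also over `J[B]`). -/
def Rep.normalHomology {J G : Type u} [CommRing J] [Group G] (B : Subgroup G) [B.Normal]
    (A : Rep.{u} J G) (p : ℕ) : Rep.{u} J (G ⧸ B) :=
  ((Rep.quotientToCoinvariantsFunctor.{u} J B).leftDerived p).obj A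

/-- The `J`-module underlying `B`-coinvariants, as `J ⊗ Res_B` followed by coinvariants. -/
def Rep.quotientToCoinvariantsForgetIso (J : Type u) {G : Type u} [CommRing J] [Group G]
    (B : Subgroup G) [B.Normal] :
    Rep.quotientToCoinvariantsFunctor.{u} J B ⋙
        forget₂ (Rep.{u} J (G ⧸ B)) (ModuleCat.{u} J) ≅
      Rep.resFunctor.{u} B.subtype ⋙ (Rep.coinvariantsTensor J B).obj (Rep.trivial J B J) :=
  (Iso.refl _ :
    Rep.quotientToCoinvariantsFunctor.{u} J B ⋙ forget₂ (Rep.{u} J (G ⧸ B)) (ModuleCat.{u} J) ≅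
      Rep.resFunctor.{u} B.subtype ⋙ Rep.coinvariantsFunctor J B) ≪≫
    Functor.isoWhiskerLeft (Rep.resFunctor.{u} B.subtype)
      (Functor.isoWhiskerRight (MonoidalCategory.leftUnitorNatIso (Rep.{u} J B)).symm
        (Rep.coinvariantsFunctor J B))

/-- The `J`-module underlying `H_p(B, J)` is the usual group homology of `B`. -/
def Rep.normalHomologyTrivialIso {J G : Type u} [CommRing J] [Group G] [DecidableEq G]
    (B : Subgroup G) [B.Normal] (p : ℕ) :
    (forget₂ (Rep.{u} J (G ⧸ B)) (ModuleCat.{u} J)).obj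
      (Rep.normalHomology B (Rep.trivial J G J) p) ≅ groupHomology (Rep.trivial J B J) p :=
  let P := Rep.barResolution J G
  let F := Rep.quotientToCoinvariantsFunctor.{u} J B
  let U := forget₂ (Rep.{u} J (G ⧸ B)) (ModuleCat.{u} J)
  U.mapIso (P.isoLeftDerivedObj F p) ≪≫
    ((((F.mapHomologicalComplex _).obj P.complex).sc p).mapHomologyIso U).symm ≪≫
    (HomologicalComplex.homologyFunctor _ _ p).mapIso
      ((NatIso.mapHomologicalComplex (Rep.quotientToCoinvariantsForgetIso J B) _).app P.complex) ≪≫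
    (groupHomologyIso (Rep.trivial J B J) p
      ((Rep.resFunctor.{u} B.subtype).mapProjectiveResolution P)).symm

/-- There is a resolution `⋯ → P₁ → P₀ → J → 0` of the trivial module `J` by `J[G]`-modules, each
of which is projective as a `J[B]`-module, such that all the maps
`J ⊗_{J[B]} P_{j+1} → J ⊗_{J[B]} P_j` induced on `B`-coinvariants by the differentials are zero. -/
def HasMinimalRelativeResolution (J : Type u) {G : Type u} [CommRing J] [Group G]
    (B : Subgroup G) : Prop :=
  ∃ (P : ChainComplex (Rep.{u} J G) ℕ)
    (ε : P ⟶ (ChainComplex.single₀ (Rep.{u} J G)).obj (Rep.trivial J G J)),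
    QuasiIso ε ∧
    (∀ j, Projective ((Rep.resFunctor B.subtype).obj (P.X j))) ∧
    ∀ j, (Rep.coinvariantsFunctor J B).map ((Rep.resFunctor B.subtype).map (P.d (j + 1) j)) = 0

end

/-! Let `P` be a projective resolution of `J` over `J[G]`, finitely generated up to degree `n`, and
`C` the given resolution. The identity of `J` lifts to `φ : P ⟶ C`. Over `J[B]` both are projective
resolutions, so `φ` becomes a homotopy equivalence there, and its `B`-coinvariants `P_B ⟶ C_B` form
a quasi-isomorphism of complexes over `J[H]`, where `H = G ⧸ B`. The differentials of `C_B` vanish,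
so `H_p(B, J)` is `(C_p)_B`, while `P_B` consists of projective `J[H]`-modules, finitely generated
up to degree `n`.

What remains is algebra over one ring (`Module.IsFP.of_homology`). Write `K = P_B`, with boundaries
`B_q = im d_{q+1}`. The map to homology is defined on all of `K_q`, not only on cycles, so `K_q /
B_q ≅ H_q ⊕ im d_q`. If this sum is of type `FP_m` in degree `q + 1`, then so is its summand `B_q`,
and hence `K_q / B_q` is of type `FP_{m+1}`. Descending induction from `q = n` gives type `FP_{n-q}`
for `H_q`. Closure under direct summands (`Module.IsFP.fst`) is essential. -/

/-- An inductive form of type `FP_n`: a module is of type `FP_0` if it is finitely generated, and of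
type `FP_{n+1}` if it is the quotient of a finitely generated projective module by a submodule of
type `FP_n`. -/
def Module.IsFP (R : Type u) [Ring R] :
    ℕ → ∀ (M : Type u) [AddCommGroup M] [Module R M], Prop
  | 0, M, _, _ => Module.Finite R M
  | n + 1, M, _, _ => ∃ (K : Type u) (_ : AddCommGroup K) (_ : Module R K) (f : K →ₗ[R] M),
      Module.Projective R K ∧ Module.Finite R K ∧ Function.Surjective f ∧
        Module.IsFP R n (LinearMap.ker f)

/-! ### Closure properties of type `FP_n` in its inductive form. -/

namespace Module.IsFP

variable {R : Type u} [Ring R] {M N A B C K : Type u} [AddCommGroup M] [Module R M]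
  [AddCommGroup N] [Module R N] [AddCommGroup A] [Module R A] [AddCommGroup B] [Module R B]
  [AddCommGroup C] [Module R C] [AddCommGroup K] [Module R K]

theorem of_linearEquiv {n : ℕ} (e : M ≃ₗ[R] N) (h : IsFP R n M) : IsFP R n N := by
  cases n with
  | zero =>
    have : Module.Finite R M := h
    exact Module.Finite.equiv e
  | succ n =>
    obtain ⟨K, _, _, f, hP, hF, hf, hk⟩ := h
    refine ⟨K, _, _, e.toLinearMap ∘ₗ f, hP, hF, e.surjective.comp hf, ?_⟩
    rwa [LinearEquiv.ker_comp]

theorem finite {n : ℕ} (h : IsFP R n M) : Module.Finite R M := by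
  cases n with
  | zero => exact h
  | succ n =>
    obtain ⟨K, _, _, f, _, hF, hf, _⟩ := h
    exact Module.Finite.of_surjective f hf

theorem of_succ {n : ℕ} (h : IsFP R (n + 1) M) : IsFP R n M := by
  induction n generalizing M with
  | zero => exact h.finite
  | succ n ih =>
    obtain ⟨K, _, _, f, hP, hF, hf, hk⟩ := h
    exact ⟨K, _, _, f, hP, hF, hf, ih hk⟩

theorem of_exact [Module.Projective R K] [Module.Finite R K] {n : ℕ} (i : N →ₗ[R] K)
    (f : K →ₗ[R] M) (hi : Function.Injective i) (hif : Function.Exact i f)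
    (hf : Function.Surjective f) (h : IsFP R n N) : IsFP R (n + 1) M :=
  ⟨K, _, _, f, inferInstance, inferInstance, hf,
    h.of_linearEquiv <| (LinearEquiv.ofInjective i hi).trans
      (LinearEquiv.ofEq _ _ (LinearMap.exact_iff.1 hif).symm)⟩

/-- Horseshoe argument: covers of `A` and `C` combine, through a lift of the latter to `B`, into a
cover of `B` whose kernel is an extension of the two kernels. -/
theorem of_extension {n : ℕ} (i : A →ₗ[R] B) (p : B →ₗ[R] C) (hi : Function.Injective i)
    (hip : Function.Exact i p) (hp : Function.Surjective p) (hA : IsFP R n A)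
    (hC : IsFP R n C) : IsFP R n B := by
  induction n generalizing A B C with
  | zero =>
    have : Module.Finite R A := hA
    have : Module.Finite R C := hC
    exact Module.Finite.of_exact hip hp
  | succ n ih =>
    obtain ⟨K, _, _, f, _, _, hf, hkf⟩ := hA
    obtain ⟨L, _, _, g, _, _, hg, hkg⟩ := hC
    obtain ⟨s, hs⟩ := Module.projective_lifting_property p g hp
    have hs' (y : L) : p (s y) = g y := LinearMap.congr_fun hs y
    have hpi (a : A) : p (i a) = 0 := (hip (i a)).2 ⟨a, rfl⟩
    let h : K × L →ₗ[R] B := (i ∘ₗ f).coprod s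
    have hh (z : K × L) : h z = i (f z.1) + s z.2 := rfl
    have hsurj : Function.Surjective h := by
      intro b
      obtain ⟨y, hy⟩ := hg (p b)
      obtain ⟨a, ha⟩ := (hip (b - s y)).1 (by simp [hs', hy])
      obtain ⟨x, rfl⟩ := hf a
      exact ⟨(x, y), by simp [hh, ha]⟩
    let j : LinearMap.ker f →ₗ[R] LinearMap.ker h :=
      ((LinearMap.inl R K L).comp (LinearMap.ker f).subtype).codRestrict _ fun x => by
        simp [hh]
    let q : LinearMap.ker h →ₗ[R] LinearMap.ker g :=
      ((LinearMap.snd R K L).comp (LinearMap.ker h).subtype).codRestrict _ fun z => by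
        have hz := congrArg p (show h z = 0 from z.2)
        simpa [hh, hpi, hs'] using hz
    refine ⟨K × L, _, _, h, inferInstance, inferInstance, hsurj, ih j q ?_ ?_ ?_ hkf hkg⟩
    · intro x y hxy
      exact Subtype.ext (congrArg (fun z => z.1.1) hxy)
    · intro z
      constructor
      · intro hz
        have h2 : z.1.2 = 0 := congrArg Subtype.val hz
        have h1 : i (f z.1.1) = 0 := by
          have := z.2
          rwa [LinearMap.mem_ker, hh, h2, map_zero, add_zero] at this
        exact ⟨⟨z.1.1, hi (by rw [h1, map_zero])⟩, Subtype.ext (Prod.ext rfl h2.symm)⟩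
      · rintro ⟨x, rfl⟩
        rfl
    · intro y
      obtain ⟨a, ha⟩ := (hip (s y.1)).1 (by rw [hs']; exact y.2)
      obtain ⟨x, rfl⟩ := hf a
      exact ⟨⟨(-x, y.1), by simp [hh, ha]⟩, rfl⟩

/-- By induction the other factor `N` is of type `FP_n`. If `K` covers `M × N`, the kernel of `K →
M` is an extension of `N` by the kernel of the cover, so `of_extension` applies. -/
theorem fst {n : ℕ} (h : IsFP R n (M × N)) : IsFP R n M := by
  induction n generalizing M N with
  | zero =>
    have : Module.Finite R (M × N) := h
    exact Module.Finite.of_surjective (LinearMap.fst R M N) Prod.fst_surjective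
  | succ n ih =>
    have hN : IsFP R n N := ih (h.of_succ.of_linearEquiv (LinearEquiv.prodComm R M N))
    obtain ⟨K, _, _, f, hP, hF, hf, hk⟩ := h
    have hle : LinearMap.ker f ≤ LinearMap.ker (LinearMap.fst R M N ∘ₗ f) :=
      LinearMap.ker_le_ker_comp _ _
    refine ⟨K, _, _, LinearMap.fst R M N ∘ₗ f, hP, hF, Prod.fst_surjective.comp hf,
      of_extension (Submodule.inclusion hle)
        (LinearMap.snd R M N ∘ₗ f ∘ₗ (LinearMap.ker (LinearMap.fst R M N ∘ₗ f)).subtype)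
        (Submodule.inclusion_injective hle) ?_ ?_ hk hN⟩
    · intro x
      constructor
      · intro hx
        exact ⟨⟨x.1, Prod.ext x.2 hx⟩, rfl⟩
      · rintro ⟨y, rfl⟩
        exact congrArg Prod.snd (show f y = 0 from y.2)
    · intro y
      obtain ⟨x, hx⟩ := hf (0, y)
      exact ⟨⟨x, by simp [hx]⟩, by simp [hx]⟩

theorem snd {n : ℕ} (h : IsFP R n (M × N)) : IsFP R n N :=
  (h.of_linearEquiv (LinearEquiv.prodComm R M N)).fst

/-- Let `K` be a sequence of modules with differentials `d`, finitely generated and projective up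
to degree `n`, and `f q : K q → C q` maps inducing isomorphisms from the homology of `K` to `C`.
Then `C q` is of type `FP_{n-q}`. -/
theorem of_homology {K C : ℕ → Type u} [∀ q, AddCommGroup (K q)] [∀ q, Module R (K q)]
    [∀ q, AddCommGroup (C q)] [∀ q, Module R (C q)] (n : ℕ)
    (hP : ∀ q ≤ n, Module.Projective R (K q)) (hF : ∀ q ≤ n, Module.Finite R (K q))
    (d : ∀ q, K q →ₗ[R] K (q - 1)) (f : ∀ q, K q →ₗ[R] C q)
    (hd : ∀ q x, d q (d (q + 1) x) = 0) (hf : ∀ q x, f q (d (q + 1) x) = 0)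
    (hsurj : ∀ q c, ∃ x, d q x = 0 ∧ f q x = c)
    (hex : ∀ q x, d q x = 0 → f q x = 0 → ∃ y, d (q + 1) y = x) (q : ℕ) (hq : q ≤ n) :
    IsFP R (n - q) (C q) := by
  -- The kernel of `g q` is the range of `d (q + 1)`. It is surjective because any lift `x` of a
  -- boundary can be corrected by a cycle with prescribed image in `C q`.
  let g (q : ℕ) : K q →ₗ[R] C q × LinearMap.range (d q) := (f q).prod (d q).rangeRestrict
  have hg (q : ℕ) : Function.Surjective (g q) := by
    rintro ⟨c, ⟨_, x, rfl⟩⟩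
    obtain ⟨z, hz, hz'⟩ := hsurj q (c - f q x)
    exact ⟨x + z, Prod.ext (by simp [g, hz']) (Subtype.ext (by simp [g, hz]))⟩
  suffices h : ∀ m q, q + m = n → IsFP R m (C q × LinearMap.range (d q)) from
    (h (n - q) q (by omega)).fst
  intro m
  induction m with
  | zero =>
    intro q hq
    have := hF q (by omega)
    exact Module.Finite.of_surjective (g q) (hg q)
  | succ m ih =>
    intro q hq
    have := hF q (by omega)
    have := hP q (by omega)
    have h := (ih (q + 1) (by omega)).snd
    refine of_exact (K := K q) (LinearMap.range (d (q + 1))).subtype (g q)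
      (Submodule.subtype_injective _) ?_ (hg q) h
    intro x
    constructor
    · intro hx
      obtain ⟨y, hy⟩ := hex q x (congrArg (fun z => z.2.1) hx) (congrArg Prod.fst hx)
      exact ⟨⟨x, y, hy⟩, rfl⟩
    · rintro ⟨⟨_, y, rfl⟩, rfl⟩
      exact Prod.ext (hf q y) (Subtype.ext (hd q y))

end Module.IsFP

/-! ### Augmented complexes and splicing of resolutions. -/

namespace CategoryTheory

variable {V : Type*} [Category* V] [Abelian V]

theorem toSingle₀_d_comp_f (C : ChainComplex V ℕ) {Z : V}
    (ε : C ⟶ (ChainComplex.single₀ V).obj Z) : C.d 1 0 ≫ ε.f 0 = 0 := by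
  rw [← ε.comm 1 0, HomologicalComplex.single_obj_d, Limits.comp_zero]

theorem quasiIso_toSingle₀_iff (C : ChainComplex V ℕ) {Z : V}
    (ε : C ⟶ (ChainComplex.single₀ V).obj Z) :
    QuasiIso ε ↔ (∀ n, (ShortComplex.mk _ _ (C.d_comp_d (n + 2) (n + 1) n)).Exact) ∧
      (ShortComplex.mk _ _ (toSingle₀_d_comp_f C ε)).Exact ∧ Epi (ε.f 0) := by
  have h0 : QuasiIsoAt ε 0 ↔
      (ShortComplex.mk _ _ (toSingle₀_d_comp_f C ε)).Exact ∧ Epi (ε.f 0) := by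
    rw [ChainComplex.quasiIsoAt₀_iff]
    exact ShortComplex.quasiIso_iff_of_zeros' _ (C.shape _ _ (by simp)) rfl rfl
  have hs (n : ℕ) : QuasiIsoAt ε (n + 1) ↔
      (ShortComplex.mk _ _ (C.d_comp_d (n + 2) (n + 1) n)).Exact := by
    rw [quasiIsoAt_iff_exactAt' ε (n + 1) (ChainComplex.exactAt_succ_single_obj _ _)]
    exact C.exactAt_iff' (n + 2) (n + 1) n (by simp only [ChainComplex.prev]; rfl) (by simp)
  rw [quasiIso_iff, ← h0]
  simp only [← hs]
  exact ⟨fun h => ⟨fun n => h _, h _⟩, fun h n => by cases n <;> simp only [h.1, h.2]⟩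

namespace ProjectiveResolution

/-- A projective resolution, from an exact complex of projective objects and an augmentation. -/
noncomputable def ofExact (C : ChainComplex V ℕ) {Z : V} (hC : ∀ n, Projective (C.X n))
    (p : C.X 0 ⟶ Z) (w : C.d 1 0 ≫ p = 0) (hepi : Epi p) (h₀ : (ShortComplex.mk _ _ w).Exact)
    (h : ∀ n, (ShortComplex.mk _ _ (C.d_comp_d (n + 2) (n + 1) n)).Exact) :
    ProjectiveResolution Z where
  complex := C
  projective := hC
  π := (ChainComplex.toSingle₀Equiv _ _).symm ⟨p, w⟩
  quasiIso := by
    have hp : ((ChainComplex.toSingle₀Equiv C Z).symm ⟨p, w⟩).f 0 = p := by simp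
    rw [quasiIso_toSingle₀_iff]
    refine ⟨h, ?_, ?_⟩
    · convert h₀
      exacts [rfl, heq_of_eq hp]
    · rwa [hp]

variable {S : ShortComplex V}

/-- A projective resolution of `X₁` extends along a short exact sequence `0 ⟶ X₁ ⟶ X₂ ⟶ X₃ ⟶ 0`,
with `X₂` projective, to a projective resolution of `X₃`. -/
theorem exists_splice (hS : S.ShortExact) [Projective S.X₂] (P : ProjectiveResolution S.X₁) :
    ∃ Q : ProjectiveResolution S.X₃, Q.complex.X 0 = S.X₂ ∧
      ∀ n, Q.complex.X (n + 1) = P.complex.X n := by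
  obtain ⟨p, w, hp, h₀⟩ : ∃ (p : P.complex.X 0 ⟶ S.X₁) (w : P.complex.d 1 0 ≫ p = 0), Epi p ∧
      (ShortComplex.mk _ _ w).Exact :=
    ⟨P.π.f 0, P.complex_d_comp_π_f_zero, inferInstanceAs (Epi (P.π.f 0)), P.exact₀⟩
  have := hS.mono_f
  have w' : P.complex.d 1 0 ≫ p ≫ S.f = 0 := by rw [reassoc_of% w, Limits.zero_comp]
  have w'' : (p ≫ S.f) ≫ S.g = 0 := by simp
  have h₁ : (ShortComplex.mk _ _ w').Exact := by
    let α : ShortComplex.mk _ _ w ⟶ ShortComplex.mk _ _ w' :=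
      { τ₁ := 𝟙 _, τ₂ := 𝟙 _, τ₃ := S.f }
    have : Epi α.τ₁ := inferInstanceAs (Epi (𝟙 _))
    have : IsIso α.τ₂ := inferInstanceAs (IsIso (𝟙 _))
    have : Mono α.τ₃ := inferInstanceAs (Mono S.f)
    exact (ShortComplex.exact_iff_of_epi_of_isIso_of_mono α).1 h₀
  have h₂ : (ShortComplex.mk _ _ w'').Exact := by
    let α : ShortComplex.mk _ _ w'' ⟶ S := { τ₁ := p, τ₂ := 𝟙 _, τ₃ := 𝟙 _ }
    have : Epi α.τ₁ := hp
    have : IsIso α.τ₂ := inferInstanceAs (IsIso (𝟙 _))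
    have : Mono α.τ₃ := inferInstanceAs (Mono (𝟙 _))
    exact (ShortComplex.exact_iff_of_epi_of_isIso_of_mono α).2 hS.exact
  refine ⟨ofExact (P.complex.augment (p ≫ S.f) w') ?_ S.g w'' hS.epi_g h₂ ?_, rfl, fun n => rfl⟩
  · rintro (_ | n)
    · assumption
    · exact P.projective n
  · rintro (_ | n)
    · exact h₁
    · exact P.exact_succ n

end ProjectiveResolution

end CategoryTheory

/-! ### Passage between the inductive form and complexes. -/

theorem ModuleCat.IsTypeFP.of_surjective {R : Type u} [Ring R] {n : ℕ} {M : ModuleCat.{u} R}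
    {K : Type u} [AddCommGroup K] [Module R K]
    [Module.Projective R K] [Module.Finite R K] (f : K →ₗ[R] M) (hf : Function.Surjective f)
    (P : ProjectiveResolution (ModuleCat.of R (LinearMap.ker f)))
    (hP : ∀ i < n, Module.Finite R (P.complex.X i)) : M.IsTypeFP n := by
  let S : ShortComplex (ModuleCat.{u} R) :=
    ShortComplex.mk (ModuleCat.ofHom (LinearMap.ker f).subtype) (ModuleCat.ofHom f)
      (by ext x; exact x.2)
  have hS : S.ShortExact :=
    { exact := (ShortComplex.moduleCat_exact_iff_range_eq_ker S).2 (Submodule.range_subtype _)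
      mono_f := (ModuleCat.mono_iff_injective _).2 (Submodule.subtype_injective _)
      epi_g := (ModuleCat.epi_iff_surjective _).2 hf }
  have : Projective S.X₂ := (IsProjective.iff_projective K).1 inferInstance
  obtain ⟨Q, h₀, h⟩ := P.exists_splice hS
  refine ⟨Q, fun i hi => ?_⟩
  cases i with
  | zero => rw [h₀]; assumption
  | succ i => rw [h]; exact hP i (by omega)

theorem Module.IsFP.isTypeFP {R : Type u} [Ring R] {n : ℕ} {M : ModuleCat.{u} R}
    (h : Module.IsFP R n M) : M.IsTypeFP n := by
  induction n generalizing M with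
  | zero =>
    have : Module.Finite R M := h
    obtain ⟨m, f, hf⟩ := Module.Finite.exists_fin' R M
    let g : (ULift.{u} (Fin m) → R) →ₗ[R] M :=
      f ∘ₗ (LinearEquiv.funCongrLeft R R Equiv.ulift.symm).toLinearMap
    -- No finiteness is required of the resolution of the kernel, since `i < 0` is impossible.
    exact .of_surjective g (hf.comp (LinearEquiv.surjective _)) (projectiveResolution _)
      (by simp)
  | succ n ih =>
    obtain ⟨K, _, _, f, _, _, hf, hk⟩ := h
    obtain ⟨P, hP⟩ := ih (M := ModuleCat.of R (LinearMap.ker f)) hk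
    exact .of_surjective f hf P fun i hi => hP i (by omega)

/-- If `f : K ⟶ C` is a quasi-isomorphism from a complex of projective modules, finitely generated
up to degree `n`, to a complex with zero differentials, then `C.X q` is of type `FP_{n-q}`. -/
theorem Module.IsFP.of_quasiIso {R : Type u} [Ring R] {K C : ChainComplex (ModuleCat.{u} R) ℕ}
    (f : K ⟶ C) [QuasiIso f] (hC : ∀ j, C.d (j + 1) j = 0) (n : ℕ)
    (hP : ∀ q ≤ n, CategoryTheory.Projective (K.X q)) (hF : ∀ q ≤ n, Module.Finite R (K.X q)) (q : ℕ)
    (hq : q ≤ n) : Module.IsFP R (n - q) (C.X q) := by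
  have hC' (i j) : C.d i j = 0 := by
    by_cases h : j + 1 = i
    · subst h; exact hC j
    · exact C.shape _ _ h
  have hfd (i j) (x : K.X i) : (f.f j).hom ((K.d i j).hom x) = 0 := by
    rw [← LinearMap.comp_apply, ← ModuleCat.hom_comp, ← f.comm, hC', Limits.comp_zero]; rfl
  have hprev (q : ℕ) : (ComplexShape.down ℕ).prev q = q + 1 := by simp
  -- For `q = 0` both sides are `0`, and `K.d 0 0` is zero, so every element of degree `0` is a
  -- cycle.
  have hnext (q : ℕ) : (ComplexShape.down ℕ).next q = q - 1 := by cases q <;> simp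
  -- Elements are encoded as maps from `R`; a refinement is then an epimorphism onto `R`, and
  -- evaluating at a preimage of `1` returns to elements.
  let u {M : ModuleCat.{u} R} (x : M) : ModuleCat.of R R ⟶ M :=
    ModuleCat.ofHom (LinearMap.toSpanSingleton R M x)
  have hu {M : ModuleCat.{u} R} (x : M) : (u x).hom (1 : R) = x := one_smul _ _
  have hu' {M N : ModuleCat.{u} R} (x : M) (g : M ⟶ N) : u x ≫ g = u (g.hom x) := by
    ext; simp [u]
  have hu0 {M : ModuleCat.{u} R} : u (0 : M) = 0 := by ext; simp [u]
  refine Module.IsFP.of_homology (R := R) (K := fun q => K.X q) (C := fun q => C.X q) n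
    (fun q hq => (IsProjective.iff_projective _).2 (hP q hq)) hF (fun q => (K.d q (q - 1)).hom)
    (fun q => (f.f q).hom) ?_ (fun q x => hfd _ _ x) ?_ ?_ q hq
  · intro q x
    exact congr($(K.d_comp_d (q + 1) q (q - 1)).hom x)
  · intro q c
    obtain ⟨A, π, hπ, x, hx, y, hy⟩ :=
      (HomologicalComplex.epi_homologyMap_iff_up_to_refinements f (q + 1) q (q - 1) (hprev q)
        (hnext q)).1 inferInstance (u c) (by rw [hC', Limits.comp_zero])
    obtain ⟨a, ha⟩ := (ModuleCat.epi_iff_surjective π).1 hπ (1 : R)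
    refine ⟨x.hom a, congr($(hx).hom a), ?_⟩
    rw [hC', Limits.comp_zero, add_zero] at hy
    have h := congr($(hy).hom a)
    simp only [ModuleCat.hom_comp, LinearMap.comp_apply, ha, hu] at h
    exact h.symm
  · intro q x hx hfx
    obtain ⟨A, π, hπ, y, hy⟩ :=
      (HomologicalComplex.mono_homologyMap_iff_up_to_refinements f (q + 1) q (q - 1) (hprev q)
        (hnext q)).1 inferInstance (u x) (by rw [hu', hx, hu0])
          0 (by rw [hu', hfx, hu0, Limits.zero_comp])
    obtain ⟨a, ha⟩ := (ModuleCat.epi_iff_surjective π).1 hπ (1 : R)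
    refine ⟨y.hom a, ?_⟩
    have h := congr($(hy).hom a)
    simp only [ModuleCat.hom_comp, LinearMap.comp_apply, ha, hu] at h
    exact h.symm

namespace CategoryTheory.ProjectiveResolution

variable {V : Type*} [Category* V] [Abelian V]

/-- A projective resolution of `Z` maps to every resolution of `Z`. -/
theorem exists_lift {Z : V} (P : ProjectiveResolution Z) (C : ChainComplex V ℕ)
    (ε : C ⟶ (ChainComplex.single₀ V).obj Z) [QuasiIso ε] :
    ∃ φ : P.complex ⟶ C, φ ≫ ε = P.π := by
  obtain ⟨hs, h₀, hepi⟩ := (quasiIso_toSingle₀_iff C ε).1 inferInstance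
  let f₀ : P.complex.X 0 ⟶ C.X 0 := Projective.factorThru (P.π.f 0) (ε.f 0)
  have hf₀ : f₀ ≫ ε.f 0 = P.π.f 0 := Projective.factorThru_comp _ _
  let f₁ : P.complex.X 1 ⟶ C.X 1 := h₀.liftFromProjective (P.complex.d 1 0 ≫ f₀) (by
    simp only [Category.assoc, hf₀, complex_d_comp_π_f_zero])
  have hf₁ : f₁ ≫ C.d 1 0 = P.complex.d 1 0 ≫ f₀ := h₀.liftFromProjective_comp _ _
  refine ⟨ChainComplex.mkHom _ _ f₀ f₁ hf₁ fun n ⟨g, g', w⟩ =>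
    ⟨(hs n).liftFromProjective (P.complex.d (n + 2) (n + 1) ≫ g') ?_,
      (hs n).liftFromProjective_comp _ _⟩, ?_⟩
  · simp [w]
  · apply HomologicalComplex.to_single_hom_ext
    exact hf₀

end CategoryTheory.ProjectiveResolution

/-! ### Coinvariants under a normal subgroup. -/

namespace Rep

variable (J : Type u) {G : Type u} [CommRing J] [Group G] (B : Subgroup G) [B.Normal]

/-- Coinvariants under a normal subgroup are left adjoint to inflation. -/
noncomputable def quotientToCoinvariantsAdjunction :
    Rep.quotientToCoinvariantsFunctor.{u} J B ⊣ Rep.resFunctor.{u} (QuotientGroup.mk' B) where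
  unit := { app X := Rep.toCoinvariantsMkQ X B }
  counit :=
    { app X := Rep.ofHom ⟨Representation.Coinvariants.lift _ LinearMap.id fun b => by
          ext x
          change X.ρ (QuotientGroup.mk (b : G)) x = x
          rw [(QuotientGroup.eq_one_iff (b : G)).2 b.2, map_one, Module.End.one_apply],
        fun g => by
          obtain ⟨g, rfl⟩ := QuotientGroup.mk_surjective g
          ext x
          rfl⟩
      naturality X Y f := by
        ext x
        obtain ⟨x, rfl⟩ := Representation.Coinvariants.mk_surjective _ x
        rfl }
  left_triangle_components X := by
    ext x
    obtain ⟨x, rfl⟩ := Representation.Coinvariants.mk_surjective _ x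
    rfl
  right_triangle_components X := by
    ext x
    rfl

instance : (Rep.quotientToCoinvariantsFunctor.{u} J B).IsLeftAdjoint :=
  (quotientToCoinvariantsAdjunction J B).isLeftAdjoint

/-- The right adjoint, inflation, preserves epimorphisms. -/
instance : (Rep.quotientToCoinvariantsFunctor.{u} J B).PreservesProjectiveObjects :=
  Functor.preservesProjectiveObjects_of_adjunction_of_preservesEpimorphisms
    (quotientToCoinvariantsAdjunction J B)

/-- The projection to coinvariants is surjective and semilinear over `J[G] → J[G ⧸ B]`, so images of
generators generate. -/
theorem quotientToCoinvariantsFunctor_finite (X : Rep.{u} J G)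
    (h : Module.Finite (MonoidAlgebra J G) (Rep.toModuleMonoidAlgebra.obj X)) :
    Module.Finite (MonoidAlgebra J (G ⧸ B))
      (Rep.toModuleMonoidAlgebra.obj ((Rep.quotientToCoinvariantsFunctor.{u} J B).obj X)) := by
  let Y := (Rep.quotientToCoinvariantsFunctor.{u} J B).obj X
  let m : X.V →ₗ[J] Y.V := Representation.Coinvariants.mk (X.ρ.comp B.subtype)
  let σ := MonoidAlgebra.mapDomainAlgHom J J (QuotientGroup.mk' B)
  have hm (r : MonoidAlgebra J G) (x : X.V) :
      m (X.ρ.asAlgebraHom r x) = Y.ρ.asAlgebraHom (σ r) (m x) := by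
    induction r using MonoidAlgebra.induction_on with
    | of g => simp [σ]; rfl
    | add a b ha hb => simp only [map_add, LinearMap.add_apply, ha, hb]
    | smul r a ha => simp only [map_smul, LinearMap.smul_apply, ha]
  let f : X.ρ.asModule →ₛₗ[(σ : MonoidAlgebra J G →+* MonoidAlgebra J (G ⧸ B))] Y.ρ.asModule :=
    { toFun := m
      map_add' := m.map_add
      map_smul' := hm }
  have : Module.Finite (MonoidAlgebra J G) X.ρ.asModule := h
  exact Module.Finite.of_surjective f
    (Representation.Coinvariants.mk_surjective (X.ρ.comp B.subtype))

end Rep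

/-- Transport of a projective resolution along an isomorphism. -/
noncomputable def CategoryTheory.ProjectiveResolution.ofIso {V : Type*} [Category* V] [Abelian V]
    {Z Z' : V} (P : ProjectiveResolution Z) (e : Z ≅ Z') : ProjectiveResolution Z' where
  complex := P.complex
  projective := P.projective
  π := P.π ≫ (ChainComplex.single₀ V).map e.hom

theorem ModuleCat.IsTypeFP.of_iso {R : Type u} [Ring R] {M N : ModuleCat.{u} R} (e : M ≅ N)
    {n : ℕ} (h : M.IsTypeFP n) : N.IsTypeFP n := by
  obtain ⟨P, hP⟩ := h
  exact ⟨P.ofIso e, hP⟩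

namespace Rep

variable {J : Type u} {G : Type u} [CommRing J] [Group G] (B : Subgroup G) [B.Normal]

instance : (Rep.toModuleMonoidAlgebra.{u} (k := J) (G := G)).Additive where
  map_add := rfl

theorem IsTypeFP.of_iso {M N : Rep.{u} J G} (e : M ≅ N) {n : ℕ} (h : M.IsTypeFP n) :
    N.IsTypeFP n :=
  ModuleCat.IsTypeFP.of_iso (Rep.toModuleMonoidAlgebra.mapIso e) h

theorem IsTypeFP.exists_projectiveResolution {M : Rep.{u} J G} {n : ℕ} (h : M.IsTypeFP n) :
    ∃ P : ProjectiveResolution M, ∀ i ≤ n,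
      Module.Finite (MonoidAlgebra J G) (Rep.toModuleMonoidAlgebra.obj (P.complex.X i)) := by
  obtain ⟨P, hP⟩ := h
  let E := Rep.equivalenceModuleMonoidAlgebra.{u} (k := J) (G := G)
  have : E.functor.Additive := inferInstanceAs (Rep.toModuleMonoidAlgebra.{u}).Additive
  have : E.inverse.Additive := E.inverse_additive
  let Q := E.inverse.mapProjectiveResolution P
  refine ⟨Q.ofIso (E.unitIso.app M).symm, fun i hi => ?_⟩
  have : Module.Finite (MonoidAlgebra J G) (P.complex.X i) := hP i hi
  exact Module.Finite.equiv (M := P.complex.X i)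
    (E.counitIso.app (P.complex.X i)).symm.toLinearEquiv

/-- A map between resolutions by representations which are projective over a normal subgroup `B`
induces a quasi-isomorphism on `B`-coinvariants. -/
theorem quasiIso_quotientToCoinvariants_map {M : Rep.{u} J G}
    {K C : ChainComplex (Rep.{u} J G) ℕ} (φ : K ⟶ C)
    (π : K ⟶ (ChainComplex.single₀ _).obj M) (ε : C ⟶ (ChainComplex.single₀ _).obj M)
    [QuasiIso π] [QuasiIso ε] (hφ : φ ≫ ε = π)
    (hK : ∀ j, Projective ((Rep.resFunctor B.subtype).obj (K.X j)))
    (hC : ∀ j, Projective ((Rep.resFunctor B.subtype).obj (C.X j))) :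
    QuasiIso (((Rep.quotientToCoinvariantsFunctor.{u} J B).mapHomologicalComplex _).map φ) := by
  let r := Rep.resFunctor.{u} (k := J) B.subtype
  let P : ProjectiveResolution (r.obj M) :=
    { complex := (r.mapHomologicalComplex _).obj K
      projective := hK
      π := (r.mapHomologicalComplex _).map π ≫
        (HomologicalComplex.singleMapHomologicalComplex _ _ _).hom.app _ }
  let Q : ProjectiveResolution (r.obj M) :=
    { complex := (r.mapHomologicalComplex _).obj C
      projective := hC
      π := (r.mapHomologicalComplex _).map ε ≫
        (HomologicalComplex.singleMapHomologicalComplex _ _ _).hom.app _ }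
  let ψ : P.complex ⟶ Q.complex := (r.mapHomologicalComplex _).map φ
  have hψ : ψ ≫ Q.π = P.π := by
    change (r.mapHomologicalComplex _).map φ ≫ (r.mapHomologicalComplex _).map ε ≫ _ =
      (r.mapHomologicalComplex _).map π ≫ _
    rw [← Functor.map_comp_assoc, hφ]
  -- Both maps lift the identity of `M`, so they are homotopic; hence `ψ` is itself a homotopy
  -- equivalence, a property that additive functors preserve.
  have h₁ : Homotopy ψ (ProjectiveResolution.homotopyEquiv P Q).hom :=
    ProjectiveResolution.liftHomotopy (𝟙 _) _ _ (by simp [hψ]) (by simp)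
  let e : HomotopyEquiv P.complex Q.complex :=
    { ProjectiveResolution.homotopyEquiv P Q with
      hom := ψ
      homotopyHomInvId := (h₁.compRight _).trans
        (ProjectiveResolution.homotopyEquiv P Q).homotopyHomInvId
      homotopyInvHomId := (h₁.compLeft _).trans
        (ProjectiveResolution.homotopyEquiv P Q).homotopyInvHomId }
  have h₂ : QuasiIso (((Rep.coinvariantsFunctor J B).mapHomologicalComplex _).map ψ) :=
    inferInstanceAs (QuasiIso ((Rep.coinvariantsFunctor J B).mapHomotopyEquiv e).hom)
  -- Quasi-isomorphisms are detected on underlying `J`-modules, where only the action of `B`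
  -- matters.
  have : QuasiIso (((forget₂ (Rep.{u} J (G ⧸ B)) (ModuleCat.{u} J)).mapHomologicalComplex _).map
    (((Rep.quotientToCoinvariantsFunctor.{u} J B).mapHomologicalComplex _).map φ)) := h₂
  exact (HomologicalComplex.quasiIso_map_iff_of_preservesHomology _ _).1 this

/-- Coinvariants of the trivial representation. -/
noncomputable def quotientToCoinvariantsTrivialIso :
    (Rep.quotientToCoinvariantsFunctor.{u} J B).obj (Rep.trivial J G J) ≅
      Rep.trivial J (G ⧸ B) J := by
  refine Rep.mkIso (.mk (LinearEquiv.ofLinearMap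
    (Representation.Coinvariants.lift _ LinearMap.id fun _ => rfl)
    (Representation.Coinvariants.mk _) ?_ ?_) ?_)
  · ext
    rfl
  · ext
    rfl
  · intro g
    obtain ⟨g, rfl⟩ := QuotientGroup.mk_surjective g
    ext
    rfl

end Rep

/-! ### The main theorem. -/

theorem mainTheorem7 {J G : Type u} [CommRing J] [Group G] (B : Subgroup G) [B.Normal]
    (hB : HasMinimalRelativeResolution J B) (n : ℕ) (hG : Group.IsTypeFP J G n) :
    (∀ p ≤ n, (Rep.normalHomology B (Rep.trivial J G J) p).IsTypeFP (n - p)) ∧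
      Group.IsTypeFP J (G ⧸ B) n := by
  suffices h : ∀ p ≤ n, (Rep.normalHomology B (Rep.trivial J G J) p).IsTypeFP (n - p) by
    -- The last claim is the case `p = 0`, as `H_0(B, J) = J_B = J`.
    refine ⟨h, (h 0 n.zero_le).of_iso ?_⟩
    exact (Rep.quotientToCoinvariantsFunctor.{u} J B).leftDerivedZeroIsoSelf.app _ ≪≫
      Rep.quotientToCoinvariantsTrivialIso B
  intro p hp
  obtain ⟨C, ε, _, hC, hd⟩ := hB
  obtain ⟨P, hP⟩ := hG.exists_projectiveResolution
  obtain ⟨φ, hφ⟩ := P.exists_lift C ε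
  let F := Rep.quotientToCoinvariantsFunctor.{u} J B
  let E := Rep.toModuleMonoidAlgebra.{u} (k := J) (G := G ⧸ B)
  have := Rep.quasiIso_quotientToCoinvariants_map B φ P.π ε hφ
    (fun j => (Rep.resFunctor B.subtype).projective_obj _) hC
  have hFd (j : ℕ) : F.map (C.d (j + 1) j) = 0 := by
    ext x
    exact congr($(hd j).hom x)
  have hFd' (i j : ℕ) : F.map (C.d i j) = 0 := by
    by_cases h : j + 1 = i
    · subst h; exact hFd j
    · rw [C.shape _ _ h, Functor.map_zero]
  let CF := (F.mapHomologicalComplex _).obj C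
  -- With zero differentials the complex is its own homology, and `φ` carries this to the homology
  -- computed by `P`.
  have e : F.obj (C.X p) ≅ Rep.normalHomology B (Rep.trivial J G J) p :=
    (ShortComplex.LeftHomologyData.ofZeros (CF.sc p) (hFd' _ _) (hFd' _ _)).homologyIso.symm ≪≫
      (asIso (HomologicalComplex.homologyMap ((F.mapHomologicalComplex _).map φ) p)).symm ≪≫
      (P.isoLeftDerivedObj F p).symm
  refine Rep.IsTypeFP.of_iso e (Module.IsFP.isTypeFP ?_)
  exact Module.IsFP.of_quasiIso
    ((E.mapHomologicalComplex _).map ((F.mapHomologicalComplex _).map φ))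
    (fun j => by
      change E.map (F.map (C.d (j + 1) j)) = 0
      rw [hFd, Functor.map_zero]) n
    (fun q hq => E.projective_obj_of_projective (F.projective_obj (P.complex.X q)))
    (fun q hq => Rep.quotientToCoinvariantsFunctor_finite J B _ (hP q hq)) p hp
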